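/- Let $d\ge 2$ be an integer and let $0<\alpha\le 2$. If $\alpha=d=2$, put $\operatorname{cap}(r):=(\log\frac1r)^{-1}$ (for $0<r<1$) and $G(x,y):=\log\frac1{|x-y|}$; otherwise put $\operatorname{cap}(r):=r^{d-\alpha}$ and $G(x,y):=|x-y|^{\alpha-d}$, for $x,y\in\mathbb R^d$, with $G(x,x):=+\infty$ in all cases. (So $\alpha=2$ is classical potential theory and $\alpha<2$ is the case of Riesz potentials.) Let $\phi\colon(0,\infty)\to(0,\infty]$ be a measure function, that is, $\phi$ is increasing and $\lim_{t\to0}\phi(t)=0$, and suppose that $$\liminf_{t\to0}\ \phi(t)/\operatorname{cap}(t)=0 .$$ Then there is a nonpolar compact set $F\subset B(0,1)$ of Cantor type such that $m_\phi(F)=0$ and $B(0,1)\setminus F$ is connected. Here $B(x,r)$ is the open Euclidean ball in $\mathbb R^d$, and $$m_\phi(E):=\lim_{\rho\to0}\ \inf\Bigl\{\sum_{n\in\mathbb N}\phi(r_n)\colon E\subset\bigcup_{n\in\mathbb N}B(x_n,r_n),\ 0<r_n<\rho\text{ for each }n\Bigr\}.$$ A set $E\subset\mathbb R^d$ is polar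 (with respect to $G$) if there is a locally finite Borel measure $\nu$ on $\mathbb R^d$ whose potential $G\nu(x)=\int G(x,y)\,d\nu(y)$ is well defined with values in $(-\infty,+\infty]$ for all $x$, is not identically $+\infty$, and equals $+\infty$ at every point of $E$; otherwise $E$ is nonpolar. A set $F$ is of Cantor type if $F=\bigcap_{m\ge0}F_m$, where, for some real numbers $a_m>0$ and integers $n_m\ge2$ with $2a_{m+1}<a_m/n_m$ ($m\ge0$), $F_0$ is a closed axis-parallel cube with diagonal of length $a_0$, and $F_{m+1}$ is obtained from the finite union $F_m$ of cubes with diagonal $a_m$ by cutting each of these cubes into $n_m^d$ congruent cubes in the canonical way and replacing each of the latter by the closed concentric axis-parallel cube with diagonal $a_{m+1}$. -/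

import Mathlib

open Set Filter Topology MeasureTheory
open scoped ENNReal

noncomputable section

namespace CantorPotential

/-- The function `cap` attached to dimension `d` and index `α`: it is `(log (1/r))⁻¹` in the
logarithmic case `α = d = 2`, and `r ^ (d - α)` otherwise. Only small `r > 0` matter. -/
def capFn (d : ℕ) (α r : ℝ) : ℝ :=
  if α = 2 ∧ d = 2 then (Real.log (1 / r))⁻¹ else r ^ ((d : ℝ) - α)

/-- The kernel `G(x, y)`, with value `+∞` on the diagonal: it is `log (1 / |x - y|)` in the
logarithmic case `α = d = 2`, and `|x - y| ^ (α - d)` otherwise. -/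
def kernel {d : ℕ} (α : ℝ) (x y : EuclideanSpace ℝ (Fin d)) : EReal :=
  if α = 2 ∧ d = 2 then -ENNReal.log (edist x y)
  else ((edist x y ^ (α - (d : ℝ)) : ℝ≥0∞) : EReal)

/-- The integral of the negative part of `G(x, ·)` (it is zero except in the logarithmic case). -/
def negPotential {d : ℕ} (α : ℝ) (ν : Measure (EuclideanSpace ℝ (Fin d)))
    (x : EuclideanSpace ℝ (Fin d)) : ℝ≥0∞ :=
  ∫⁻ y, (-kernel α x y).toENNReal ∂ν

/-- The potential `Gν(x) = ∫ G(x, y) dν(y)`, the integral of the positive part minus the integral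
of the negative part. It is used only where `negPotential` is finite. -/
def potential {d : ℕ} (α : ℝ) (ν : Measure (EuclideanSpace ℝ (Fin d)))
    (x : EuclideanSpace ℝ (Fin d)) : EReal :=
  ((∫⁻ y, (kernel α x y).toENNReal ∂ν : ℝ≥0∞) : EReal) - (negPotential α ν x : EReal)

/-- A set is polar if some potential `Gν` of a Radon measure (well defined with values in
`(-∞, +∞]`, and not identically `+∞`) is equal to `+∞` at every point of the set. -/
def IsPolar {d : ℕ} (α : ℝ) (E : Set (EuclideanSpace ℝ (Fin d))) : Prop :=
  ∃ ν : Measure (EuclideanSpace ℝ (Fin d)), IsLocallyFiniteMeasure ν ∧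
    (∀ x, negPotential α ν x < ⊤) ∧ (∃ x, potential α ν x < ⊤) ∧ ∀ x ∈ E, potential α ν x = ⊤

/-- Measure functions `φ : (0, ∞) → (0, ∞]`; the values of `φ` outside `(0, ∞)` are irrelevant. -/
structure IsMeasureFunction (φ : ℝ → ℝ≥0∞) : Prop where
  pos : ∀ t, 0 < t → 0 < φ t
  mono : MonotoneOn φ (Ioi 0)
  tendsto_zero : Tendsto φ (𝓝[>] 0) (𝓝 0)

/-- `M_φ^(ρ)(E)`: the infimum of `∑ φ(r_n)` over the countable covers of `E` by open balls
`B(x_n, r_n)` with `0 < r_n < ρ`. -/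
def hausdorffContent {d : ℕ} (φ : ℝ → ℝ≥0∞) (ρ : ℝ) (E : Set (EuclideanSpace ℝ (Fin d))) : ℝ≥0∞ :=
  ⨅ (x : ℕ → EuclideanSpace ℝ (Fin d)) (r : ℕ → ℝ) (_ : ∀ n, 0 < r n ∧ r n < ρ)
    (_ : E ⊆ ⋃ n, Metric.ball (x n) (r n)), ∑' n, φ (r n)

/-- `m_φ(E) = lim_{ρ → 0} M_φ^(ρ)(E)`. As `M_φ^(ρ)(E)` increases when `ρ` decreases, the limit is
the supremum over `ρ > 0`. -/
def hausdorffM {d : ℕ} (φ : ℝ → ℝ≥0∞) (E : Set (EuclideanSpace ℝ (Fin d))) : ℝ≥0∞ :=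
  ⨆ (ρ : ℝ) (_ : 0 < ρ), hausdorffContent φ ρ E

/-- The closed axis-parallel cube with center `c` whose diagonal has length `a`. -/
def cube {d : ℕ} (c : EuclideanSpace ℝ (Fin d)) (a : ℝ) : Set (EuclideanSpace ℝ (Fin d)) :=
  {y | ∀ i, |y i - c i| ≤ a / (2 * √(d : ℝ))}

/-- The centers of the cubes of generation `m`. Generation `0` is one cube with center `z`. To pass
from `m` to `m + 1`, each cube of generation `m` (of diagonal `a m`) is cut into `(n m) ^ d`
congruent cubes in the canonical way, and the centers of all these are taken. -/
def cantorCenters {d : ℕ} (z : EuclideanSpace ℝ (Fin d)) (a : ℕ → ℝ) (n : ℕ → ℕ) :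
    ℕ → Set (EuclideanSpace ℝ (Fin d))
  | 0 => {z}
  | m + 1 => {c' | ∃ c ∈ cantorCenters z a n m, ∃ k : Fin d → Fin (n m), ∀ i,
      c' i = c i + (2 * ((k i : ℕ) : ℝ) + 1 - (n m : ℝ)) / (n m : ℝ) * (a m / (2 * √(d : ℝ)))}

/-- A set of Cantor type: `F = ⋂ F_m`, where `F_0` is a cube and where `F_(m+1)` arises from `F_m` by
cutting every cube of `F_m` (of diagonal `a m`) into `(n m) ^ d` congruent cubes (of diagonal
`a m / n m`) and by replacing each of these by the concentric cube of diagonal `a (m + 1)`,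
less than half as large. -/
def IsCantorType {d : ℕ} (F : Set (EuclideanSpace ℝ (Fin d))) : Prop :=
  ∃ (z : EuclideanSpace ℝ (Fin d)) (a : ℕ → ℝ) (n : ℕ → ℕ),
    (∀ m, 0 < a m) ∧ (∀ m, 2 ≤ n m) ∧ (∀ m, 2 * a (m + 1) < a m / (n m : ℝ)) ∧
      F = ⋂ m, ⋃ c ∈ cantorCenters z a n m, cube c (a m)

end CantorPotential

end

noncomputable section

namespace CantorPotential

section

/-- The midpoints of the intervals of generation `m` of a one-dimensional Cantor construction,
enumerated from left to right. Here `h m` is half the length of an interval of generation `m`. -/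
def midpoint1 (h : ℕ → ℝ) (n : ℕ → ℕ) : ℕ → ℕ → ℝ
  | 0, k => k * (2 * h 0)
  | m + 1, k => midpoint1 h n m (k / n m) +
      (2 * ((k % n m : ℕ) : ℝ) + 1 - (n m : ℝ)) / (n m : ℝ) * h m

/-- The number of intervals of generation `m`. -/
def count1 (n : ℕ → ℕ) (m : ℕ) : ℕ := ∏ i ∈ Finset.range m, n i

lemma count1_succ (n : ℕ → ℕ) (m : ℕ) : count1 n (m + 1) = count1 n m * n m :=
  Finset.prod_range_succ _ _

lemma count1_pos {n : ℕ → ℕ} (hn : ∀ m, 2 ≤ n m) (m : ℕ) : 0 < count1 n m :=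
  Finset.prod_pos fun i _ => by have := hn i; omega

/-- The admissible parameters of a one-dimensional Cantor construction. -/
structure Admissible (h : ℕ → ℝ) (n : ℕ → ℕ) : Prop where
  pos : ∀ m, 0 < h m
  two_le : ∀ m, 2 ≤ n m
  lt : ∀ m, 2 * h (m + 1) < h m / n m

variable {h : ℕ → ℝ} {n : ℕ → ℕ}

lemma Admissible.natCast_pos (H : Admissible h n) (m : ℕ) : (0 : ℝ) < n m := by
  have := H.two_le m
  exact_mod_cast (by omega : 0 < n m)

lemma midpoint1_succ_sub (H : Admissible h n) (m : ℕ)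
    (S : ∀ k k' : ℕ, k ≤ k' → ((k' : ℝ) - k) * (2 * h m) ≤ midpoint1 h n m k' - midpoint1 h n m k)
    {k k' : ℕ} (hk : k ≤ k') :
    ((k' : ℝ) - k) * (2 * h m / n m) ≤ midpoint1 h n (m + 1) k' - midpoint1 h n (m + 1) k := by
  have hn := H.natCast_pos m
  have h1 := S _ _ (Nat.div_le_div_right (c := n m) hk)
  have e1 : (k : ℝ) = n m * ((k / n m : ℕ) : ℝ) + ((k % n m : ℕ) : ℝ) := by
    exact_mod_cast (Nat.div_add_mod k (n m)).symm
  have e2 : (k' : ℝ) = n m * ((k' / n m : ℕ) : ℝ) + ((k' % n m : ℕ) : ℝ) := by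
    exact_mod_cast (Nat.div_add_mod k' (n m)).symm
  simp only [midpoint1]
  have e3 : ((k' : ℝ) - k) * (2 * h m / n m) =
      (((k' / n m : ℕ) : ℝ) - ((k / n m : ℕ) : ℝ)) * (2 * h m) +
      ((2 * ((k' % n m : ℕ) : ℝ) + 1 - (n m : ℝ)) / (n m : ℝ) * h m -
      (2 * ((k % n m : ℕ) : ℝ) + 1 - (n m : ℝ)) / (n m : ℝ) * h m) := by
    rw [e1, e2]
    field_simp
    ring
  rw [e3]
  linarith

lemma midpoint1_sub (H : Admissible h n) (m : ℕ) {k k' : ℕ} (hk : k ≤ k') :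
    ((k' : ℝ) - k) * (2 * h m) ≤ midpoint1 h n m k' - midpoint1 h n m k := by
  induction m generalizing k k' with
  | zero => simp only [midpoint1]; linarith
  | succ m ih =>
    refine le_trans ?_ (midpoint1_succ_sub H m (fun _ _ => ih) hk)
    have hkk : (0 : ℝ) ≤ (k' : ℝ) - k := sub_nonneg.2 (by exact_mod_cast hk)
    have h0 := H.pos (m + 1)
    have := H.lt m
    refine mul_le_mul_of_nonneg_left ?_ hkk
    rw [mul_div_assoc]
    linarith

lemma midpoint1_mono (H : Admissible h n) (m : ℕ) : Monotone (midpoint1 h n m) := fun k k' hk => by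
  have h1 := midpoint1_sub H m hk
  have h2 := H.pos m
  have hkk : (0 : ℝ) ≤ (k' : ℝ) - k := sub_nonneg.2 (by exact_mod_cast hk)
  nlinarith [mul_nonneg hkk h2.le]

lemma abs_midpoint1_succ_sub (H : Admissible h n) (m k : ℕ) :
    |midpoint1 h n (m + 1) k - midpoint1 h n m (k / n m)| + h (m + 1) ≤ h m := by
  have hn := H.natCast_pos m
  have h1 := H.lt m
  have h2 := H.pos m
  have h4 := H.pos (m + 1)
  have h3 : k % n m + 1 ≤ n m := Nat.mod_lt k (by exact_mod_cast hn)
  have h3' : ((k % n m : ℕ) : ℝ) + 1 ≤ n m := by exact_mod_cast h3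
  have h5 : (0 : ℝ) ≤ ((k % n m : ℕ) : ℝ) := Nat.cast_nonneg _
  simp only [midpoint1, add_sub_cancel_left]
  rw [abs_mul, abs_div, abs_of_pos hn, abs_of_pos h2]
  have h6 : |2 * ((k % n m : ℕ) : ℝ) + 1 - (n m : ℝ)| ≤ n m - 1 := by
    rw [abs_le]; constructor <;> linarith
  have h7 : |2 * ((k % n m : ℕ) : ℝ) + 1 - (n m : ℝ)| / n m * h m ≤ (n m - 1) / n m * h m := by
    gcongr
  have h8 : ((n m : ℝ) - 1) / n m * h m = h m - h m / n m := by field_simp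
  linarith

/-- The index of the interval of generation `m` that belongs to the parameter `x`. -/
def index1 (n : ℕ → ℕ) (m : ℕ) (x : ℝ) : ℕ := ⌊(count1 n m : ℝ) * x⌋₊

lemma index1_div (H : Admissible h n) (m : ℕ) (x : ℝ) :
    index1 n (m + 1) x / n m = index1 n m x := by
  have hn := H.natCast_pos m
  rw [index1, ← Nat.floor_div_natCast, index1, count1_succ]
  push_cast
  congr 1
  field_simp

lemma index1_lt (H : Admissible h n) (m : ℕ) {x : ℝ} (hx : x ∈ Ico (0 : ℝ) 1) :
    index1 n m x < count1 n m := by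
  have : (0 : ℝ) < count1 n m := by exact_mod_cast count1_pos H.two_le m
  rw [index1, Nat.floor_lt (mul_nonneg this.le hx.1)]
  nlinarith [hx.2]

lemma index1_mono (n : ℕ → ℕ) (m : ℕ) : Monotone (index1 n m) := fun _ _ hxy =>
  Nat.floor_mono (mul_le_mul_of_nonneg_left hxy (Nat.cast_nonneg _))

/-- The monotone parametrization of a one-dimensional Cantor set. -/
def param1 (h : ℕ → ℝ) (n : ℕ → ℕ) (x : ℝ) : ℝ :=
  ⨆ m, (midpoint1 h n m (index1 n m x) - h m)

lemma antitone_interval (H : Admissible h n) (x : ℝ) :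
    Antitone fun m => Icc (midpoint1 h n m (index1 n m x) - h m)
      (midpoint1 h n m (index1 n m x) + h m) := by
  refine antitone_nat_of_succ_le fun m => ?_
  have h1 := abs_midpoint1_succ_sub H m (index1 n (m + 1) x)
  rw [index1_div H] at h1
  have h2 := abs_le.1 (le_sub_iff_add_le.2 h1)
  exact Icc_subset_Icc (by linarith) (by linarith)

lemma param1_mem (H : Admissible h n) (m : ℕ) (x : ℝ) :
    |param1 h n x - midpoint1 h n m (index1 n m x)| ≤ h m := by
  have h1 := ciSup_mem_iInter_Icc_of_antitone_Icc (antitone_interval H x)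
    (fun m => by linarith [H.pos m])
  have h2 := mem_iInter.1 h1 m
  rw [← param1] at h2
  rw [abs_le]
  constructor <;> linarith [h2.1, h2.2]

lemma param1_mono (H : Admissible h n) : Monotone (param1 h n) := fun x y hxy => by
  refine ciSup_mono ⟨midpoint1 h n 0 (index1 n 0 y) + h 0, ?_⟩ fun m => ?_
  · rintro _ ⟨m, rfl⟩
    exact (antitone_interval H y (Nat.zero_le m)
      (left_mem_Icc.2 (by linarith [H.pos m]))).2
  · exact sub_le_sub_right (midpoint1_mono H m (index1_mono n m hxy)) _

lemma sub_le_of_param1 (H : Admissible h n) (m : ℕ) {x y s : ℝ} (hx : 0 ≤ x)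
    (hs : 0 ≤ s) (hxy : |param1 h n y - param1 h n x| ≤ s) :
    y - x ≤ ((s + 2 * h (m + 1)) / (2 * h m / n m) + 1) / count1 n (m + 1) := by
  have hN : (0 : ℝ) < count1 n (m + 1) := by exact_mod_cast count1_pos H.two_le (m + 1)
  have hn := H.natCast_pos m
  have h0 := H.pos m
  have h1 := H.pos (m + 1)
  have hδ : 0 < 2 * h m / n m := by positivity
  rcases le_total y x with hle | hle
  · exact (sub_nonpos.2 hle).trans (by positivity)
  have e1 := midpoint1_succ_sub H m (fun _ _ => midpoint1_sub H m) (index1_mono n (m + 1) hle)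
  have e2 := abs_le.1 (param1_mem H (m + 1) x)
  have e3 := abs_le.1 (param1_mem H (m + 1) y)
  have e4 := abs_le.1 hxy
  have e5 : (index1 n (m + 1) y : ℝ) - index1 n (m + 1) x ≤
      (s + 2 * h (m + 1)) / (2 * h m / n m) := by
    rw [le_div_iff₀ hδ]
    linarith
  have e6 : (index1 n (m + 1) x : ℝ) ≤ count1 n (m + 1) * x := Nat.floor_le (by positivity)
  have e7 : (count1 n (m + 1) : ℝ) * y < index1 n (m + 1) y + 1 := Nat.lt_floor_add_one _
  rw [le_div_iff₀ hN]
  linarith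

variable {d : ℕ}

/-- The parametrization of a Cantor set in `ℝ ^ d` by points of `ℝ ^ d`. -/
def param (d : ℕ) (h : ℕ → ℝ) (n : ℕ → ℕ) (x : Fin d → ℝ) : EuclideanSpace ℝ (Fin d) :=
  WithLp.toLp 2 fun i => param1 h n (x i)

lemma measurable_param (H : Admissible h n) : Measurable (param d h n) := by
  refine (WithLp.measurable_toLp 2 _).comp (measurable_pi_lambda _ fun i => ?_)
  exact (param1_mono H).measurable.comp (measurable_pi_apply i)

lemma volume_param_mem_closedBall_le (H : Admissible h n) (m : ℕ) (y : EuclideanSpace ℝ (Fin d))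
    {r : ℝ} (hr : 0 ≤ r) :
    volume {x : Fin d → ℝ | (∀ i, 0 ≤ x i) ∧ dist (param d h n x) y ≤ r} ≤
      ENNReal.ofReal (((2 * r + 2 * h (m + 1)) / (2 * h m / n m) + 1) / count1 n (m + 1)) ^ d := by
  refine (Real.volume_pi_le_diam_pow _).trans ?_
  rw [Fintype.card_fin]
  gcongr
  refine Metric.ediam_le fun x hx x' hx' => ?_
  rw [edist_pi_le_iff]
  intro i
  have h1 : ∀ z : Fin d → ℝ, dist (param d h n z) y ≤ r → |param1 h n (z i) - y i| ≤ r := by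
    intro z hz
    rw [dist_eq_norm] at hz
    exact (PiLp.norm_apply_le (param d h n z - y) i).trans hz
  have h2 := abs_le.1 (h1 x hx.2)
  have h3 := abs_le.1 (h1 x' hx'.2)
  rw [edist_dist, Real.dist_eq]
  refine ENNReal.ofReal_le_ofReal (abs_le.2 ⟨?_, ?_⟩)
  · have := sub_le_of_param1 H m (s := 2 * r) (hx.1 i) (by positivity)
      (abs_le.2 ⟨by linarith, by linarith⟩)
    linarith
  · exact sub_le_of_param1 H m (s := 2 * r) (hx'.1 i) (by positivity)
      (abs_le.2 ⟨by linarith, by linarith⟩)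

end

section

variable {h : ℕ → ℝ} {n : ℕ → ℕ} {d : ℕ}

/-- The one-dimensional approximation of generation `m`. -/
def stage1 (h : ℕ → ℝ) (n : ℕ → ℕ) (m : ℕ) : Set ℝ :=
  {t | ∃ k < count1 n m, |t - midpoint1 h n m k| ≤ h m}

/-- The `d`-fold product of a one-dimensional Cantor set. -/
def cantorSet (d : ℕ) (h : ℕ → ℝ) (n : ℕ → ℕ) : Set (EuclideanSpace ℝ (Fin d)) :=
  {y | ∀ m i, y i ∈ stage1 h n m}

/-- Half the side length of a cube in `ℝ ^ d` with diagonal `a`. -/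
def halfSide (d : ℕ) (a : ℕ → ℝ) (m : ℕ) : ℝ := a m / (2 * √(d : ℝ))

lemma mem_cantorCenters_iff {a : ℕ → ℝ} (H : Admissible (halfSide d a) n) (m : ℕ)
    (c : EuclideanSpace ℝ (Fin d)) :
    c ∈ cantorCenters 0 a n m ↔ ∀ i, ∃ k < count1 n m, c i = midpoint1 (halfSide d a) n m k := by
  induction m generalizing c with
  | zero =>
    simp only [cantorCenters, mem_singleton_iff, count1, Finset.range_zero, Finset.prod_empty,
      Nat.lt_one_iff, exists_eq_left, midpoint1, Nat.cast_zero, zero_mul]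
    constructor
    · rintro rfl i; rfl
    · intro hc; ext i; exact hc i
  | succ m ih =>
    have hn : 0 < n m := by have := H.two_le m; omega
    simp only [cantorCenters, mem_ofPred_eq]
    constructor
    · rintro ⟨c0, hc0, k, hk⟩ i
      obtain ⟨q, hq, hcq⟩ := (ih c0).1 hc0 i
      refine ⟨n m * q + k i, ?_, ?_⟩
      · rw [count1_succ]
        have h1 := (k i).2
        have h2 : q + 1 ≤ count1 n m := hq
        nlinarith
      · rw [hk i, hcq, midpoint1, Nat.mul_add_div hn, Nat.div_eq_of_lt (k i).2,
          Nat.mul_add_mod, Nat.mod_eq_of_lt (k i).2, add_zero, halfSide]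
    · intro hc
      choose K hK hcK using hc
      refine ⟨WithLp.toLp 2 fun i => midpoint1 (halfSide d a) n m (K i / n m), ?_,
        fun i => ⟨K i % n m, Nat.mod_lt _ hn⟩, fun i => ?_⟩
      · rw [ih]
        refine fun i => ⟨K i / n m, ?_, rfl⟩
        rw [Nat.div_lt_iff_lt_mul hn, ← count1_succ]
        exact hK i
      · rw [hcK i, midpoint1, halfSide]

lemma iUnion_cube_eq {a : ℕ → ℝ} (H : Admissible (halfSide d a) n) (m : ℕ) :
    ⋃ c ∈ cantorCenters (0 : EuclideanSpace ℝ (Fin d)) a n m, cube c (a m) =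
      {y | ∀ i, y i ∈ stage1 (halfSide d a) n m} := by
  ext y
  simp only [mem_iUnion, cube, mem_ofPred_eq, stage1, exists_prop]
  constructor
  · rintro ⟨c, hc, hy⟩ i
    obtain ⟨k, hk, hck⟩ := (mem_cantorCenters_iff H m c).1 hc i
    exact ⟨k, hk, by rw [← hck]; exact hy i⟩
  · intro hy
    choose K hK hyK using hy
    refine ⟨WithLp.toLp 2 fun i => midpoint1 (halfSide d a) n m (K i), ?_, hyK⟩
    rw [mem_cantorCenters_iff H]
    exact fun i => ⟨K i, hK i, rfl⟩

lemma cantorSet_eq_iInter {a : ℕ → ℝ} (H : Admissible (halfSide d a) n) :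
    cantorSet d (halfSide d a) n =
      ⋂ m, ⋃ c ∈ cantorCenters (0 : EuclideanSpace ℝ (Fin d)) a n m, cube c (a m) := by
  ext y
  simp only [iUnion_cube_eq H, mem_iInter]
  rfl

lemma admissible_halfSide (hd : 0 < d) {a : ℕ → ℝ} (ha : ∀ m, 0 < a m) (hn : ∀ m, 2 ≤ n m)
    (han : ∀ m, 2 * a (m + 1) < a m / (n m : ℝ)) : Admissible (halfSide d a) n := by
  have hs : 0 < 2 * √(d : ℝ) := by positivity
  refine ⟨fun m => div_pos (ha m) hs, hn, fun m => ?_⟩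
  have := div_lt_div_of_pos_right (han m) hs
  rw [div_right_comm] at this
  rwa [halfSide, halfSide, ← mul_div_assoc]

lemma isClosed_stage1 (h : ℕ → ℝ) (n : ℕ → ℕ) (m : ℕ) : IsClosed (stage1 h n m) := by
  have : stage1 h n m = ⋃ k ∈ Finset.range (count1 n m),
      Metric.closedBall (midpoint1 h n m k) (h m) := by
    ext t
    simp [stage1, Real.dist_eq]
  rw [this]
  exact isClosed_biUnion_finset fun _ _ => Metric.isClosed_closedBall

lemma isClosed_cantorSet (d : ℕ) (h : ℕ → ℝ) (n : ℕ → ℕ) : IsClosed (cantorSet d h n) := by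
  simp only [cantorSet, ofPred_forall]
  exact isClosed_iInter fun m => isClosed_iInter fun i =>
    (isClosed_stage1 h n m).preimage (by fun_prop)

lemma norm_le_of_abs_le (y : EuclideanSpace ℝ (Fin d)) {s : ℝ} (hs : 0 ≤ s)
    (hy : ∀ i, |y i| ≤ s) : ‖y‖ ≤ √(d : ℝ) * s := by
  rw [EuclideanSpace.norm_eq, ← Real.sqrt_sq hs, ← Real.sqrt_mul (Nat.cast_nonneg _)]
  refine Real.sqrt_le_sqrt ?_
  calc ∑ i, ‖y i‖ ^ 2 ≤ ∑ _i : Fin d, s ^ 2 :=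
        Finset.sum_le_sum fun i _ => pow_le_pow_left₀ (norm_nonneg _) (hy i) 2
    _ = d * s ^ 2 := by simp

lemma cube_subset_closedBall (hd : 0 < d) (c : EuclideanSpace ℝ (Fin d)) {a : ℝ} (ha : 0 ≤ a) :
    cube c a ⊆ Metric.closedBall c (a / 2) := by
  intro y hy
  rw [mem_closedBall_iff_norm]
  refine (norm_le_of_abs_le (y - c) (s := a / (2 * √(d : ℝ))) (by positivity) hy).trans
    (le_of_eq ?_)
  have : √(d : ℝ) ≠ 0 := by positivity
  field_simp

lemma abs_le_of_mem_cantorSet {y : EuclideanSpace ℝ (Fin d)} (hy : y ∈ cantorSet d h n)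
    (i : Fin d) : |y i| ≤ h 0 := by
  obtain ⟨k, hk, hyk⟩ := hy 0 i
  simp only [count1, Finset.range_zero, Finset.prod_empty, Nat.lt_one_iff] at hk
  simpa [hk, midpoint1] using hyk

lemma param_mem_cantorSet (H : Admissible h n) {x : Fin d → ℝ} (hx : ∀ i, x i ∈ Ico (0 : ℝ) 1) :
    param d h n x ∈ cantorSet d h n := fun m i =>
  ⟨index1 n m (x i), index1_lt H m (hx i), param1_mem H m (x i)⟩

/-- A point outside `C ^ d` has a coordinate for which the whole slice avoids `C ^ d`. -/
lemma exists_slice {x : EuclideanSpace ℝ (Fin d)} (hx : x ∉ cantorSet d h n) :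
    ∃ i, ∀ y : EuclideanSpace ℝ (Fin d), y i = x i → y ∉ cantorSet d h n := by
  simp only [cantorSet, mem_ofPred_eq, not_forall] at hx ⊢
  obtain ⟨m, i, hmi⟩ := hx
  exact ⟨i, fun y hy => ⟨m, i, by rwa [hy]⟩⟩

lemma joinedIn_of_coord {S : Set (EuclideanSpace ℝ (Fin d))}
    {x y : EuclideanSpace ℝ (Fin d)} (hx : ‖x‖ < 1) (hy : ‖y‖ < 1)
    (hS : ∀ z ∈ segment ℝ x y, z ∉ S) : JoinedIn (Metric.ball 0 1 \ S) x y := by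
  refine JoinedIn.of_segment_subset fun z hz => ⟨?_, hS z hz⟩
  exact (convex_ball _ _).segment_subset (by simpa using hx) (by simpa using hy) hz

lemma segment_coord {x y z : EuclideanSpace ℝ (Fin d)} (hz : z ∈ segment ℝ x y) (i : Fin d) :
    z i ∈ segment ℝ (x i) (y i) := by
  obtain ⟨s, t, hs, ht, hst, rfl⟩ := hz
  exact ⟨s, t, hs, ht, hst, by simp⟩

lemma norm_single_add_lt {i j : Fin d} (hij : i ≠ j) {s t : ℝ} (hs : |s| ≤ 1 / 2)
    (ht : |t| ≤ 1 / 2) :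
    ‖EuclideanSpace.single i s + EuclideanSpace.single j t‖ < 1 := by
  have h1 : ‖EuclideanSpace.single i s + EuclideanSpace.single j t‖ ^ 2 = s ^ 2 + t ^ 2 := by
    rw [norm_add_sq_real]
    simp [EuclideanSpace.inner_single_left, hij]
  have h2 : s ^ 2 ≤ (1 / 2) ^ 2 := sq_le_sq' (abs_le.1 hs).1 (abs_le.1 hs).2
  have h3 : t ^ 2 ≤ (1 / 2) ^ 2 := sq_le_sq' (abs_le.1 ht).1 (abs_le.1 ht).2
  nlinarith [norm_nonneg (EuclideanSpace.single i s + EuclideanSpace.single j t)]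

lemma isConnected_ball_diff_cantorSet (hd : 2 ≤ d) (hh : h 0 < 1 / 2) :
    IsConnected (Metric.ball (0 : EuclideanSpace ℝ (Fin d)) 1 \ cantorSet d h n) := by
  set S := cantorSet d h n
  have far : ∀ (y : EuclideanSpace ℝ (Fin d)) (i : Fin d), 1 / 2 ≤ |y i| → y ∉ S := by
    intro y i hi hy
    have := abs_le_of_mem_cantorSet hy i
    linarith
  have hsingle : ∀ (i : Fin d) (s : ℝ), |s| ≤ 1 / 2 →
      ‖(EuclideanSpace.single i s : EuclideanSpace ℝ (Fin d))‖ < 1 := by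
    intro i s hs
    rw [PiLp.norm_single, Real.norm_eq_abs]
    linarith
  have hhalf : |(1 / 2 : ℝ)| ≤ 1 / 2 := by rw [abs_of_pos] <;> norm_num
  -- two points with a common coordinate whose slice avoids `S`
  have slice : ∀ (i : Fin d) (x y : EuclideanSpace ℝ (Fin d)), ‖x‖ < 1 → ‖y‖ < 1 → y i = x i →
      (∀ z : EuclideanSpace ℝ (Fin d), z i = x i → z ∉ S) →
      JoinedIn (Metric.ball 0 1 \ S) x y := by
    intro i x y hx hy hxy hS
    refine joinedIn_of_coord hx hy fun z hz => hS z ?_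
    have := segment_coord hz i
    rwa [hxy, segment_same, mem_singleton_iff] at this
  have corner : ∀ (i j : Fin d) (s : ℝ), i ≠ j → |s| ≤ 1 / 2 →
      (∀ z : EuclideanSpace ℝ (Fin d), z i = s → z ∉ S) →
      JoinedIn (Metric.ball 0 1 \ S) (EuclideanSpace.single i s) (EuclideanSpace.single j (1 / 2)) := by
    intro i j s hij hs hS
    have hn := norm_single_add_lt hij hs hhalf
    refine (slice i _ (EuclideanSpace.single i s + EuclideanSpace.single j (1 / 2))
      (hsingle i s hs) hn ?_ ?_).trans (slice j _ _ hn (hsingle j _ hhalf) ?_ ?_)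
    · simp [hij]
    · intro z hz; exact hS z (by simpa using hz)
    · simp [hij]
    · intro z hz
      refine far z j ?_
      rw [hz]
      simp [hij.symm]
  let i0 : Fin d := ⟨0, by omega⟩
  let i1 : Fin d := ⟨1, by omega⟩
  have hi : i0 ≠ i1 := by simp [i0, i1]
  have hub : ∀ i : Fin d, JoinedIn (Metric.ball 0 1 \ S) (EuclideanSpace.single i (1 / 2))
      (EuclideanSpace.single i0 (1 / 2)) := by
    intro i
    by_cases hii : i = i0
    · rw [hii]
      refine JoinedIn.refl ⟨by simpa using hsingle i0 (1 / 2) hhalf, far _ i0 ?_⟩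
      simp [abs_of_pos]
    · refine corner i i0 _ hii hhalf fun z hz => far z i ?_
      rw [hz, abs_of_pos] <;> norm_num
  have arm : ∀ (i : Fin d) (s : ℝ), |s| ≤ 1 / 2 →
      (∀ z : EuclideanSpace ℝ (Fin d), z i = s → z ∉ S) →
      JoinedIn (Metric.ball 0 1 \ S) (EuclideanSpace.single i s)
        (EuclideanSpace.single i0 (1 / 2)) := by
    intro i s hs hS
    obtain ⟨j, hij⟩ : ∃ j, i ≠ j := by
      by_cases hii : i = i0
      · exact ⟨i1, by rw [hii]; exact hi⟩
      · exact ⟨i0, hii⟩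
    exact (corner i j s hij hs hS).trans (hub j)
  have hp : (EuclideanSpace.single i0 (1 / 2) : EuclideanSpace ℝ (Fin d)) ∈
      Metric.ball 0 1 \ S := (hub i0).source_mem
  have key : IsPathConnected (Metric.ball (0 : EuclideanSpace ℝ (Fin d)) 1 \ S) := by
    refine ⟨_, hp, fun x hx => JoinedIn.symm ?_⟩
    have hx1 : ‖x‖ < 1 := by simpa using hx.1
    obtain ⟨i, hi⟩ := exists_slice hx.2
    rcases le_or_gt |x i| (1 / 2) with hle | hgt
    · exact (slice i x (EuclideanSpace.single i (x i)) hx1 (hsingle i _ hle) (by simp) hi).trans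
        (arm i _ hle hi)
    · obtain ⟨s, hs, hsx⟩ : ∃ s : ℝ, |s| = 1 / 2 ∧ ∀ t ∈ segment ℝ (x i) s, 1 / 2 ≤ |t| := by
        rcases lt_abs.1 hgt with h1 | h1
        · refine ⟨1 / 2, by rw [abs_of_pos] <;> norm_num, fun t ht => ?_⟩
          rw [segment_symm, segment_eq_Icc h1.le] at ht
          exact ht.1.trans (le_abs_self t)
        · refine ⟨-(1 / 2), by rw [abs_neg, abs_of_pos] <;> norm_num, fun t ht => ?_⟩
          rw [segment_eq_Icc (by linarith)] at ht
          exact (le_neg.1 ht.2).trans (neg_le_abs t)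
      refine JoinedIn.trans (y := EuclideanSpace.single i s) ?_ (arm i s hs.le fun z hz => ?_)
      · refine joinedIn_of_coord hx1 (hsingle i s hs.le) fun z hz => far z i (hsx _ ?_)
        simpa using segment_coord hz i
      · exact far z i (by rw [hz, hs])
  exact key.isConnected

end

section

variable {n : ℕ → ℕ} {d : ℕ}

/-- A set that is covered by finitely many balls of radius `s < ρ` has small `φ`-content. -/
lemma hausdorffContent_le_of_finite_cover {φ : ℝ → ℝ≥0∞} (hφ : IsMeasureFunction φ) {ρ s : ℝ}
    (hs : 0 < s) (hsρ : s < ρ) {E : Set (EuclideanSpace ℝ (Fin d))} {N : ℕ}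
    (c : Fin N → EuclideanSpace ℝ (Fin d)) (hE : E ⊆ ⋃ k, Metric.ball (c k) s) :
    hausdorffContent φ ρ E ≤ N * φ s := by
  refine ENNReal.le_of_forall_pos_le_add fun ε hε _ => ?_
  obtain ⟨δ, hδ, hδsum⟩ := ENNReal.exists_pos_sum_of_countable (ε := (ε : ℝ≥0∞))
    (by exact_mod_cast hε.ne') ℕ
  have hex : ∀ k, ∃ r : ℝ, (0 < r ∧ r < ρ) ∧ φ r ≤ δ k := by
    intro k
    have h1 : ∀ᶠ r in 𝓝[>] (0 : ℝ), φ r < δ k :=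
      hφ.tendsto_zero.eventually (gt_mem_nhds (by exact_mod_cast hδ k))
    have h2 : ∀ᶠ r in 𝓝[>] (0 : ℝ), r ∈ Ioo 0 ρ := Ioo_mem_nhdsGT (hs.trans hsρ)
    obtain ⟨r, hr1, hr2⟩ := (h1.and h2).exists
    exact ⟨r, hr2, hr1.le⟩
  choose r hr hrδ using hex
  let x : ℕ → EuclideanSpace ℝ (Fin d) := fun k => if hk : k < N then c ⟨k, hk⟩ else 0
  let R : ℕ → ℝ := fun k => if k < N then s else r k
  have hR : ∀ k, 0 < R k ∧ R k < ρ := by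
    intro k
    by_cases hk : k < N
    · simpa [R, hk] using ⟨hs, hsρ⟩
    · simpa [R, hk] using hr k
  have hcov : E ⊆ ⋃ k, Metric.ball (x k) (R k) := by
    refine hE.trans (iUnion_subset fun k => ?_)
    refine subset_iUnion_of_subset k ?_
    simp [x, R]
  refine (iInf₂_le_of_le x R (iInf₂_le hR hcov)).trans ?_
  calc ∑' k, φ (R k) ≤ ∑' k, ((if k < N then φ s else 0) + δ k) := by
        refine ENNReal.tsum_le_tsum fun k => ?_
        by_cases hk : k < N
        · simp [R, hk]
        · simpa [R, hk] using hrδ k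
    _ = (∑' k, if k < N then φ s else 0) + ∑' k, (δ k : ℝ≥0∞) := ENNReal.tsum_add
    _ ≤ N * φ s + ε := by
        refine add_le_add (le_of_eq ?_) hδsum.le
        rw [tsum_eq_sum (s := Finset.range N) (fun k hk => by simp_all)]
        rw [Finset.sum_congr rfl (fun k hk => if_pos (Finset.mem_range.1 hk))]
        simp

lemma hausdorffContent_cantorSet_le (hd : 0 < d) {a : ℕ → ℝ} (ha : ∀ m, 0 < a m)
    {φ : ℝ → ℝ≥0∞} (hφ : IsMeasureFunction φ)
    {ρ : ℝ} (m : ℕ) (hm : a m < ρ) :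
    hausdorffContent φ ρ (cantorSet d (halfSide d a) n) ≤ (count1 n m : ℝ≥0∞) ^ d * φ (a m) := by
  have hcard : Fintype.card (Fin d → Fin (count1 n m)) = count1 n m ^ d := by simp
  let e := Fintype.equivFinOfCardEq hcard
  let c : Fin (count1 n m ^ d) → EuclideanSpace ℝ (Fin d) := fun k =>
    WithLp.toLp 2 fun i => midpoint1 (halfSide d a) n m (e.symm k i)
  have := hausdorffContent_le_of_finite_cover hφ (ha m) hm (N := count1 n m ^ d)
    (E := cantorSet d (halfSide d a) n) c ?_
  · exact_mod_cast this
  intro y hy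
  choose K hK hyK using hy m
  refine mem_iUnion.2 ⟨e fun i => ⟨K i, hK i⟩, ?_⟩
  refine Metric.closedBall_subset_ball (by linarith [ha m] : a m / 2 < a m)
    (cube_subset_closedBall hd _ (ha m).le fun i => ?_)
  simpa [c, halfSide] using hyK i

lemma hausdorffM_cantorSet_eq_zero (hd : 0 < d) {a : ℕ → ℝ} (ha : ∀ m, 0 < a m)
    {φ : ℝ → ℝ≥0∞} (hφ : IsMeasureFunction φ) (hlim : Tendsto a atTop (𝓝 0))
    (hN : Tendsto (fun m => (count1 n m : ℝ≥0∞) ^ d * φ (a m)) atTop (𝓝 0)) :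
    hausdorffM φ (cantorSet d (halfSide d a) n) = 0 := by
  simp only [hausdorffM, ENNReal.iSup_eq_zero]
  intro ρ hρ
  refine le_antisymm (ge_of_tendsto hN ?_) zero_le
  filter_upwards [hlim.eventually (gt_mem_nhds hρ)] with m hm
  exact hausdorffContent_cantorSet_le hd ha hφ m hm

lemma volume_param_mem_closedBall_le_pow (hd : 0 < d) {a : ℕ → ℝ} {p : ℕ → ℕ}
    (ha : ∀ m, 0 < a m)
    (H : Admissible (halfSide d a) fun m => 2 ^ p m) (y : EuclideanSpace ℝ (Fin d)) {m j : ℕ}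
    (hj : j ≤ p m) :
    volume {x : Fin d → ℝ | (∀ i, 0 ≤ x i) ∧
      dist (param d (halfSide d a) (fun m => 2 ^ p m) x) y ≤ a m / 2 ^ j} ≤
      ENNReal.ofReal (2 * √(d : ℝ) + 2) ^ d / (2 ^ d) ^ j /
        (count1 (fun m => 2 ^ p m) m : ℝ≥0∞) ^ d := by
  have hN : (0 : ℝ) < count1 (fun m => 2 ^ p m) m := by exact_mod_cast count1_pos H.two_le m
  refine (volume_param_mem_closedBall_le H m y (div_pos (ha m) (by positivity)).le).trans ?_
  have e1 : ENNReal.ofReal (2 * √(d : ℝ) + 2) ^ d / (2 ^ d) ^ j /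
        (count1 (fun m => 2 ^ p m) m : ℝ≥0∞) ^ d =
      ENNReal.ofReal ((2 * √(d : ℝ) + 2) / 2 ^ j / count1 (fun m => 2 ^ p m) m) ^ d := by
    rw [ENNReal.ofReal_div_of_pos hN, ENNReal.ofReal_div_of_pos (by positivity),
      ENNReal.ofReal_pow (by norm_num), ENNReal.ofReal_natCast, ENNReal.ofReal_ofNat]
    simp only [div_eq_mul_inv, mul_pow, ENNReal.inv_pow, pow_right_comm]
  rw [e1]
  gcongr ENNReal.ofReal ?_ ^ d
  rw [count1_succ]
  push_cast
  have hs : 0 < √(d : ℝ) := by positivity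
  have h1 := H.lt m
  have h2 := H.pos m
  have h3 : (2 : ℝ) ^ j ≤ 2 ^ p m := pow_le_pow_right₀ (by norm_num) hj
  have ham : a m = 2 * √(d : ℝ) * halfSide d a m := by rw [halfSide]; field_simp
  rw [ham]
  set u := halfSide d a m with hu
  set v := halfSide d a (m + 1)
  push_cast at h1
  rw [lt_div_iff₀ (by positivity)] at h1
  have h4 : (2 * (2 * √(d : ℝ) * u / 2 ^ j) + 2 * v) / (2 * u / 2 ^ p m) + 1 ≤
      (2 * √(d : ℝ) + 2) * (2 ^ p m / 2 ^ j) := by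
    have e2 : (2 * (2 * √(d : ℝ) * u / 2 ^ j) + 2 * v) / (2 * u / 2 ^ p m) =
        2 * √(d : ℝ) * (2 ^ p m / 2 ^ j) + v * 2 ^ p m / u := by field_simp
    have e3 : v * 2 ^ p m / u ≤ 1 := by
      rw [div_le_one h2]
      have : 0 < v * 2 ^ p m := mul_pos (H.pos _) (by positivity)
      linarith
    have e4 : 1 ≤ (2 : ℝ) ^ p m / 2 ^ j := (one_le_div (by positivity)).2 h3
    rw [e2, add_mul]
    linarith
  refine (div_le_div_of_nonneg_right h4 (by positivity)).trans (le_of_eq ?_)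
  field_simp

section profile

variable {g : ℝ≥0∞ → ℝ≥0∞} {a : ℕ → ℝ} {p : ℕ → ℕ}

/-- The contributions of generation `m` to a majorant of `g`. -/
def shellSum (g : ℝ≥0∞ → ℝ≥0∞) (a : ℕ → ℝ) (p : ℕ → ℕ) (m : ℕ) (t : ℝ) : ℝ≥0∞ :=
  (∑ j ∈ Finset.range (p m),
    if t ≤ a m / 2 ^ j then g (ENNReal.ofReal (a m / 2 ^ (j + 1))) else 0) +
  if t ≤ a m / 2 ^ p m then g (ENNReal.ofReal (a (m + 1))) else 0

lemma le_tsum_shellSum (hg : Antitone g) (ha : ∀ m, 0 < a m)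
    (hlim : Tendsto a atTop (𝓝 0)) (hanti : Antitone a) (hg0 : g (ENNReal.ofReal (a 0)) ≠ 0)
    {t : ℝ} (ht : 0 ≤ t) :
    g (ENNReal.ofReal t) ≤ g (ENNReal.ofReal (a 0)) + ∑' m, shellSum g a p m t := by
  rcases ht.eq_or_lt with rfl | ht
  · have h1 : ∑' m, shellSum g a p m 0 = ⊤ := by
      refine top_unique ?_
      rw [← ENNReal.tsum_const_eq_top_of_ne_zero (α := ℕ) hg0]
      refine ENNReal.tsum_le_tsum fun m => ?_
      have h2 : (0 : ℝ) ≤ a m / 2 ^ p m := (div_pos (ha m) (by positivity)).le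
      rw [shellSum, if_pos h2]
      exact (hg (ENNReal.ofReal_le_ofReal (hanti (Nat.zero_le _)))).trans le_add_self
    rw [h1, add_top]
    exact le_top
  rcases lt_or_ge (a 0) t with h0 | h0
  · exact (hg (ENNReal.ofReal_le_ofReal h0.le)).trans le_self_add
  refine le_add_left ?_
  -- the last generation with `t ≤ a m`
  have hex : ∃ m, a m < t := (hlim.eventually (gt_mem_nhds ht)).exists
  classical
  obtain ⟨m, hm⟩ : ∃ m, Nat.find hex = m + 1 := by
    refine Nat.exists_eq_succ_of_ne_zero fun h => ?_
    have := Nat.find_spec hex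
    rw [h] at this
    exact absurd h0 (not_le.2 this)
  have h1 : a (m + 1) < t := hm ▸ Nat.find_spec hex
  have h2 : t ≤ a m := not_lt.1 (Nat.find_min hex (m := m) (by omega))
  refine le_trans ?_ (ENNReal.le_tsum m)
  rw [shellSum]
  by_cases h3 : t ≤ a m / 2 ^ p m
  · rw [if_pos h3]
    exact (hg (ENNReal.ofReal_le_ofReal h1.le)).trans le_add_self
  have hex2 : ∃ j, a m / 2 ^ j < t := ⟨p m, not_le.1 h3⟩
  obtain ⟨j, hj⟩ : ∃ j, Nat.find hex2 = j + 1 := by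
    refine Nat.exists_eq_succ_of_ne_zero fun h => ?_
    have := Nat.find_spec hex2
    rw [h, pow_zero, div_one] at this
    exact absurd h2 (not_le.2 this)
  have h4 : a m / 2 ^ (j + 1) < t := hj ▸ Nat.find_spec hex2
  have h5 : t ≤ a m / 2 ^ j := not_lt.1 (Nat.find_min hex2 (m := j) (by omega))
  have h6 : j < p m := by
    have := Nat.find_min' hex2 (not_le.1 h3)
    omega
  refine le_add_right (le_trans ?_ (Finset.single_le_sum (fun _ _ => zero_le)
    (Finset.mem_range.2 h6)))
  rw [if_pos h5]
  exact hg (ENNReal.ofReal_le_ofReal h4.le)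

lemma le_pow_mul_of_doubling {lam : ℝ≥0∞} (hdouble : ∀ t ≤ 1 / 2, g (t / 2) ≤ lam * g t)
    {t : ℝ} (ht0 : 0 < t) (ht : t ≤ 1 / 2) (j : ℕ) :
    g (ENNReal.ofReal (t / 2 ^ j)) ≤ lam ^ j * g (ENNReal.ofReal t) := by
  induction j with
  | zero => simp
  | succ j ih =>
    have e : ENNReal.ofReal (t / 2 ^ (j + 1)) = ENNReal.ofReal (t / 2 ^ j) / 2 := by
      rw [pow_succ, ← div_div, ENNReal.ofReal_div_of_pos two_pos, ENNReal.ofReal_ofNat]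
    have h1 : ENNReal.ofReal (t / 2 ^ j) ≤ 1 / 2 := by
      have : (1 / 2 : ℝ≥0∞) = ENNReal.ofReal (1 / 2) := by
        rw [ENNReal.ofReal_div_of_pos two_pos]; simp
      rw [this]
      refine ENNReal.ofReal_le_ofReal ((div_le_self ht0.le ?_).trans ht)
      exact one_le_pow₀ one_le_two
    rw [e, pow_succ', mul_assoc]
    exact (hdouble _ h1).trans (by gcongr)

/-- The parameter cube. -/
def unitCube (d : ℕ) : Set (Fin d → ℝ) := Set.univ.pi fun _ => Ico (0 : ℝ) 1

lemma volume_unitCube : volume (unitCube d) = 1 := by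
  simp [unitCube, Real.volume_pi_Ico]

/-- The natural probability measure on the Cantor set. -/
def cantorMeasure (d : ℕ) (h : ℕ → ℝ) (n : ℕ → ℕ) : Measure (EuclideanSpace ℝ (Fin d)) :=
  (volume.restrict (unitCube d)).map (param d h n)

lemma cantorMeasure_closedBall_le (hd : 0 < d) (ha : ∀ m, 0 < a m)
    (H : Admissible (halfSide d a) fun m => 2 ^ p m) (y : EuclideanSpace ℝ (Fin d)) {m j : ℕ}
    (hj : j ≤ p m) :
    cantorMeasure d (halfSide d a) (fun m => 2 ^ p m) {x | dist x y ≤ a m / 2 ^ j} ≤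
      ENNReal.ofReal (2 * √(d : ℝ) + 2) ^ d / (2 ^ d) ^ j /
        (count1 (fun m => 2 ^ p m) m : ℝ≥0∞) ^ d := by
  have hm : MeasurableSet {x | dist x y ≤ a m / 2 ^ j} := Metric.isClosed_closedBall.measurableSet
  rw [cantorMeasure, Measure.map_apply (measurable_param H) hm,
    Measure.restrict_apply (measurable_param H hm)]
  refine (measure_mono fun x hx => ?_).trans (volume_param_mem_closedBall_le_pow hd ha H y hj)
  exact ⟨fun i => (hx.2 i (mem_univ i)).1, hx.1⟩

lemma cantorMeasure_univ {h : ℕ → ℝ} (H : Admissible h n) : cantorMeasure d h n univ = 1 := by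
  rw [cantorMeasure, Measure.map_apply (measurable_param H) MeasurableSet.univ]
  simp [volume_unitCube]

lemma cantorMeasure_compl {h : ℕ → ℝ} (H : Admissible h n) :
    cantorMeasure d h n (cantorSet d h n)ᶜ = 0 := by
  rw [cantorMeasure, Measure.map_apply (measurable_param H)
    (isClosed_cantorSet d h n).measurableSet.compl,
    Measure.restrict_apply (measurable_param H (isClosed_cantorSet d h n).measurableSet.compl)]
  convert measure_empty (μ := (volume : Measure (Fin d → ℝ)))
  refine eq_empty_of_forall_notMem fun x hx => hx.1 ?_
  exact param_mem_cantorSet H fun i => hx.2 i (mem_univ i)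

lemma measurable_ite_dist_le (y : EuclideanSpace ℝ (Fin d)) (r : ℝ) (w : ℝ≥0∞) :
    Measurable fun x : EuclideanSpace ℝ (Fin d) => if dist x y ≤ r then w else 0 :=
  Measurable.ite Metric.isClosed_closedBall.measurableSet measurable_const measurable_const

lemma lintegral_shellSum_le (hd : 0 < d) (ha : ∀ m, 0 < a m) (ha2 : ∀ m, a m ≤ 1 / 2)
    (H : Admissible (halfSide d a) fun m => 2 ^ p m)
    {lam : ℝ≥0∞} (hdouble : ∀ t ≤ 1 / 2, g (t / 2) ≤ lam * g t)
    (y : EuclideanSpace ℝ (Fin d)) (m : ℕ) :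
    ∫⁻ x, shellSum g a p m (dist x y) ∂(cantorMeasure d (halfSide d a) fun m => 2 ^ p m) ≤
      ENNReal.ofReal (2 * √(d : ℝ) + 2) ^ d * (lam * (1 - lam / 2 ^ d)⁻¹) *
        (g (ENNReal.ofReal (a m)) / (count1 (fun m => 2 ^ p m) m : ℝ≥0∞) ^ d) +
      ENNReal.ofReal (2 * √(d : ℝ) + 2) ^ d * (g (ENNReal.ofReal (a (m + 1))) /
        (count1 (fun m => 2 ^ p m) (m + 1) : ℝ≥0∞) ^ d) := by
  set μ := cantorMeasure d (halfSide d a) fun m => 2 ^ p m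
  set C := ENNReal.ofReal (2 * √(d : ℝ) + 2) ^ d
  set N := (count1 (fun m => 2 ^ p m) m : ℝ≥0∞) ^ d
  have hterm : ∀ (r : ℝ) (w : ℝ≥0∞),
      ∫⁻ x, (if dist x y ≤ r then w else 0) ∂μ = w * μ {x | dist x y ≤ r} := by
    intro r w
    have hm : MeasurableSet {x | dist x y ≤ r} := Metric.isClosed_closedBall.measurableSet
    rw [← lintegral_indicator_const hm]
    rfl
  simp only [shellSum]
  rw [lintegral_add_right _ (measurable_ite_dist_le _ _ _), lintegral_finsetSum _ fun j _ => measurable_ite_dist_le _ _ _]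
  simp only [hterm]
  refine add_le_add ?_ ?_
  · calc _ ≤ ∑ j ∈ Finset.range (p m),
          lam ^ (j + 1) * g (ENNReal.ofReal (a m)) * (C / (2 ^ d) ^ j / N) := by
          refine Finset.sum_le_sum fun j hj => mul_le_mul' ?_ ?_
          · exact le_pow_mul_of_doubling hdouble (ha m) (ha2 m) (j + 1)
          · exact cantorMeasure_closedBall_le hd ha H y (Finset.mem_range.1 hj).le
      _ = ∑ j ∈ Finset.range (p m),
          C * lam * (g (ENNReal.ofReal (a m)) / N) * (lam / 2 ^ d) ^ j := by
          refine Finset.sum_congr rfl fun j _ => ?_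
          simp only [ENNReal.div_eq_inv_mul, mul_pow, ENNReal.inv_pow, pow_succ]
          ring
      _ ≤ C * lam * (g (ENNReal.ofReal (a m)) / N) * (1 - lam / 2 ^ d)⁻¹ := by
          rw [← Finset.mul_sum, ← ENNReal.tsum_geometric]
          gcongr
          exact ENNReal.sum_le_tsum _
      _ = _ := by ring
  · refine (mul_le_mul_right (cantorMeasure_closedBall_le hd ha H y le_rfl) _).trans (le_of_eq ?_)
    rw [count1_succ]
    push_cast
    rw [mul_pow, ← pow_mul, ← pow_mul, mul_comm d (p m), div_eq_mul_inv, div_eq_mul_inv,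
      div_eq_mul_inv, ENNReal.mul_inv (by simp) (by simp)]
    ring

/-- The potential of the Cantor measure is bounded. -/
lemma exists_lintegral_le (hd : 0 < d) (hg : Antitone g) (ha : ∀ m, 0 < a m)
    (ha2 : ∀ m, a m ≤ 1 / 2)
    (hlim : Tendsto a atTop (𝓝 0)) (hanti : Antitone a) (hg0 : g (ENNReal.ofReal (a 0)) ≠ 0)
    (hgt : g (ENNReal.ofReal (a 0)) ≠ ⊤)
    (H : Admissible (halfSide d a) fun m => 2 ^ p m)
    {lam : ℝ≥0∞} (hlam : lam < 2 ^ d) (hdouble : ∀ t ≤ 1 / 2, g (t / 2) ≤ lam * g t)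
    (hsum : ∑' m, g (ENNReal.ofReal (a m)) / (count1 (fun m => 2 ^ p m) m : ℝ≥0∞) ^ d ≠ ⊤) :
    ∃ K : ℝ≥0∞, K ≠ ⊤ ∧ ∀ y : EuclideanSpace ℝ (Fin d),
      ∫⁻ x, g (edist x y) ∂(cantorMeasure d (halfSide d a) fun m => 2 ^ p m) ≤ K := by
  set μ := cantorMeasure d (halfSide d a) fun m => 2 ^ p m with hμ
  set T := ∑' m, g (ENNReal.ofReal (a m)) / (count1 (fun m => 2 ^ p m) m : ℝ≥0∞) ^ d
  set C := ENNReal.ofReal (2 * √(d : ℝ) + 2) ^ d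
  have hlam' : lam / 2 ^ d < 1 := by
    rw [ENNReal.div_lt_iff (by simp) (by simp), one_mul]
    exact hlam
  have hC : C ≠ ⊤ := by simp [C]
  refine ⟨g (ENNReal.ofReal (a 0)) + (C * (lam * (1 - lam / 2 ^ d)⁻¹) * T + C * T), ?_, ?_⟩
  · have h1 : (1 - lam / 2 ^ d)⁻¹ ≠ ⊤ := by
      simpa [tsub_eq_zero_iff_le] using hlam'
    have h2 : lam ≠ ⊤ := (hlam.trans_le le_top).ne
    finiteness
  intro y
  calc ∫⁻ x, g (edist x y) ∂μ
      ≤ ∫⁻ x, (g (ENNReal.ofReal (a 0)) + ∑' m, shellSum g a p m (dist x y)) ∂μ := by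
        refine lintegral_mono fun x => ?_
        rw [edist_dist]
        exact le_tsum_shellSum hg ha hlim hanti hg0 dist_nonneg
    _ = g (ENNReal.ofReal (a 0)) + ∑' m, ∫⁻ x, shellSum g a p m (dist x y) ∂μ := by
        rw [lintegral_add_left measurable_const, lintegral_const, hμ, cantorMeasure_univ H, mul_one,
          lintegral_tsum]
        intro m
        exact (Measurable.add (Finset.measurable_fun_sum _ fun j _ => measurable_ite_dist_le _ _ _)
          (measurable_ite_dist_le _ _ _)).aemeasurable
    _ ≤ _ := by
        gcongr
        refine (ENNReal.tsum_le_tsum fun m =>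
          lintegral_shellSum_le hd ha ha2 H hdouble y m).trans ?_
        rw [ENNReal.tsum_add, ENNReal.tsum_mul_left, ENNReal.tsum_mul_left]
        gcongr
        exact ENNReal.tsum_comp_le_tsum_of_injective (add_left_injective 1)
          fun m => g (ENNReal.ofReal (a m)) / (count1 (fun m => 2 ^ p m) m : ℝ≥0∞) ^ d

end profile

end

section

variable {d : ℕ}

section parameters

variable {g : ℝ≥0∞ → ℝ≥0∞} {φ : ℝ → ℝ≥0∞}

lemma exists_next_parameters (hd : 0 < d)
    (hgtop : Tendsto (fun t : ℝ => g (ENNReal.ofReal t)) (𝓝[>] 0) (𝓝 ⊤))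
    (hgd : Tendsto (fun t : ℝ => ENNReal.ofReal t ^ d * g (ENNReal.ofReal t)) (𝓝[>] 0) (𝓝 0))
    (hfin : ∀ t : ℝ, 0 < t → g (ENNReal.ofReal t) ≠ ⊤)
    (hfreq : ∀ ε > 0, ∃ᶠ t in 𝓝[>] (0 : ℝ), φ t * g (ENNReal.ofReal t) < ε)
    (m : ℕ) {a : ℝ} (ha : 0 < a) {N : ℕ} (hN : 0 < N) :
    ∃ (b : ℝ) (q : ℕ), 0 < b ∧ 1 ≤ q ∧ 2 * b < a / 2 ^ q ∧
      2 ^ m * g (ENNReal.ofReal b) ≤ (N * 2 ^ q : ℝ≥0∞) ^ d ∧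
      (N * 2 ^ q : ℝ≥0∞) ^ d * φ b ≤ 2 ^ d * 2⁻¹ ^ m := by
  have hε : (0 : ℝ≥0∞) < (4 ^ m)⁻¹ := by simp
  set η : ℝ≥0∞ := ENNReal.ofReal a ^ d / (2 ^ d * 2 ^ d * 2 ^ m)
  have hη : 0 < η := ENNReal.div_pos (by simp [ha]) (by finiteness)
  have h1 : ∀ᶠ t in 𝓝[>] (0 : ℝ), (N : ℝ≥0∞) ^ d < g (ENNReal.ofReal t) :=
    hgtop.eventually (lt_mem_nhds (by finiteness))
  have h2 := hgd.eventually (gt_mem_nhds hη)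
  have h3 : ∀ᶠ t in 𝓝[>] (0 : ℝ), 0 < t := self_mem_nhdsWithin
  obtain ⟨b, hb, hb1, hb2, hb3⟩ := ((hfreq _ hε).and_eventually (h1.and (h2.and h3))).exists
  have hex : ∃ q : ℕ, 2 ^ m * g (ENNReal.ofReal b) ≤ (N * 2 ^ q : ℝ≥0∞) ^ d := by
    have htop : (2 : ℝ≥0∞) ^ m * g (ENNReal.ofReal b) ≠ ⊤ := by
      have := hfin b hb3
      finiteness
    obtain ⟨k, hk⟩ := ENNReal.exists_nat_gt htop
    refine ⟨k, hk.le.trans ?_⟩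
    have h4 : k ≤ (N * 2 ^ k) ^ d := calc
      k ≤ 2 ^ k := Nat.lt_two_pow_self.le
      _ ≤ N * 2 ^ k := Nat.le_mul_of_pos_left _ hN
      _ ≤ (N * 2 ^ k) ^ d := Nat.le_self_pow hd.ne' _
    exact_mod_cast h4
  classical
  obtain ⟨q, hq⟩ : ∃ q, Nat.find hex = q + 1 := by
    refine Nat.exists_eq_succ_of_ne_zero fun h => ?_
    have h4 := Nat.find_spec hex
    rw [h, pow_zero, mul_one] at h4
    refine absurd (h4.trans_lt hb1) (not_lt.2 ?_)
    exact le_mul_of_one_le_left zero_le (one_le_pow₀ one_le_two)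
  have h4 : 2 ^ m * g (ENNReal.ofReal b) ≤ (N * 2 ^ (q + 1) : ℝ≥0∞) ^ d := hq ▸ Nat.find_spec hex
  have h5 : (N * 2 ^ q : ℝ≥0∞) ^ d < 2 ^ m * g (ENNReal.ofReal b) :=
    not_le.1 (Nat.find_min hex (m := q) (by omega))
  have h6 : (N * 2 ^ (q + 1) : ℝ≥0∞) ^ d ≤ 2 ^ d * (2 ^ m * g (ENNReal.ofReal b)) := calc
    (N * 2 ^ (q + 1) : ℝ≥0∞) ^ d = 2 ^ d * (N * 2 ^ q) ^ d := by rw [← mul_pow, pow_succ]; ring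
    _ ≤ _ := by gcongr
  refine ⟨b, q + 1, hb3, by omega, ?_, h4, ?_⟩
  · rw [lt_div_iff₀ (by positivity)]
    refine lt_of_pow_lt_pow_left₀ d ha.le ?_
    rw [← ENNReal.ofReal_lt_ofReal_iff (by positivity)]
    calc ENNReal.ofReal ((2 * b * 2 ^ (q + 1)) ^ d)
        = 2 ^ d * ENNReal.ofReal b ^ d * (2 ^ (q + 1)) ^ d := by
          rw [ENNReal.ofReal_pow (by positivity), ENNReal.ofReal_mul (by positivity),
            ENNReal.ofReal_mul (by positivity), ENNReal.ofReal_pow (by positivity),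
            ENNReal.ofReal_ofNat, mul_pow, mul_pow]
      _ ≤ 2 ^ d * ENNReal.ofReal b ^ d * (N * 2 ^ (q + 1)) ^ d := by
          gcongr
          exact le_mul_of_one_le_left zero_le (by exact_mod_cast hN)
      _ ≤ 2 ^ d * ENNReal.ofReal b ^ d * (2 ^ d * (2 ^ m * g (ENNReal.ofReal b))) := by gcongr
      _ = ENNReal.ofReal b ^ d * g (ENNReal.ofReal b) * (2 ^ d * 2 ^ d * 2 ^ m) := by ring
      _ < ENNReal.ofReal a ^ d := by
          rwa [ENNReal.lt_div_iff_mul_lt (by simp) (by left; finiteness)] at hb2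
      _ = _ := by rw [ENNReal.ofReal_pow ha.le]
  · calc (N * 2 ^ (q + 1) : ℝ≥0∞) ^ d * φ b
        ≤ 2 ^ d * (2 ^ m * g (ENNReal.ofReal b)) * φ b := by gcongr
      _ = 2 ^ d * 2 ^ m * (φ b * g (ENNReal.ofReal b)) := by ring
      _ ≤ 2 ^ d * 2 ^ m * (4 ^ m)⁻¹ := by gcongr
      _ = 2 ^ d * 2⁻¹ ^ m := by
          have : (4 : ℝ≥0∞) = 2 * 2 := by norm_num
          rw [this, mul_pow, ENNReal.mul_inv (by simp) (by simp), ENNReal.inv_pow, mul_assoc,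
            ← mul_assoc (2 ^ m), ← ENNReal.inv_pow, ENNReal.mul_inv_cancel (by simp) (by simp),
            one_mul]

lemma exists_parameters (hd : 0 < d)
    (hgtop : Tendsto (fun t : ℝ => g (ENNReal.ofReal t)) (𝓝[>] 0) (𝓝 ⊤))
    (hgd : Tendsto (fun t : ℝ => ENNReal.ofReal t ^ d * g (ENNReal.ofReal t)) (𝓝[>] 0) (𝓝 0))
    (hfin : ∀ t : ℝ, 0 < t → g (ENNReal.ofReal t) ≠ ⊤)
    (hfreq : ∀ ε > 0, ∃ᶠ t in 𝓝[>] (0 : ℝ), φ t * g (ENNReal.ofReal t) < ε) :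
    ∃ (a : ℕ → ℝ) (p : ℕ → ℕ), a 0 = 1 / 2 ∧ (∀ m, 0 < a m) ∧ (∀ m, 1 ≤ p m) ∧
      (∀ m, 2 * a (m + 1) < a m / 2 ^ p m) ∧
      (∑' m, g (ENNReal.ofReal (a m)) / (count1 (fun m => 2 ^ p m) m : ℝ≥0∞) ^ d ≠ ⊤) ∧
      Tendsto (fun m => (count1 (fun m => 2 ^ p m) m : ℝ≥0∞) ^ d * φ (a m)) atTop (𝓝 0) := by
  have step := fun (m : ℕ) (s : {s : ℝ × ℕ // 0 < s.1 ∧ 0 < s.2}) =>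
    exists_next_parameters hd hgtop hgd hfin hfreq m s.2.1 s.2.2
  choose b q hb hq hlt hsum hphi using step
  let s : ℕ → {s : ℝ × ℕ // 0 < s.1 ∧ 0 < s.2} := fun m => Nat.rec ⟨(1 / 2, 1), by norm_num⟩
    (fun m s => ⟨(b m s, s.1.2 * 2 ^ q m s), hb m s, Nat.mul_pos s.2.2 (by positivity)⟩) m
  have hcount : ∀ m, (s m).1.2 = count1 (fun m => 2 ^ q m (s m)) m := by
    intro m
    induction m with
    | zero => rfl
    | succ m ih => rw [count1_succ, ← ih]
  have hcast : ∀ m, (count1 (fun m => 2 ^ q m (s m)) (m + 1) : ℝ≥0∞) =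
      (s m).1.2 * 2 ^ q m (s m) := by
    intro m
    rw [count1_succ, ← hcount]
    push_cast
    rfl
  refine ⟨fun m => (s m).1.1, fun m => q m (s m), rfl, fun m => (s m).2.1, fun m => hq m _,
    fun m => hlt m _, ?_, ?_⟩
  · rw [tsum_eq_zero_add' ENNReal.summable]
    refine ENNReal.add_ne_top.2 ⟨?_, ?_⟩
    · refine ENNReal.div_ne_top (hfin _ (s 0).2.1) ?_
      rw [← hcount]
      simp [s]
    · refine ne_top_of_le_ne_top (b := ∑' m : ℕ, (2⁻¹ : ℝ≥0∞) ^ m) ?_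
        (ENNReal.tsum_le_tsum fun m => ?_)
      · rw [ENNReal.tsum_geometric]
        simp
      · rw [hcast]
        refine ENNReal.div_le_of_le_mul ?_
        calc g (ENNReal.ofReal (s (m + 1)).1.1)
            = 2⁻¹ ^ m * (2 ^ m * g (ENNReal.ofReal (b m (s m)))) := by
              rw [← mul_assoc, ← mul_pow, ENNReal.inv_mul_cancel (by simp) (by simp), one_pow,
                one_mul]
          _ ≤ _ := by
              gcongr
              exact hsum m (s m)
  · rw [← tendsto_add_atTop_iff_nat 1]
    have hgeo : Tendsto (fun m : ℕ => (2 : ℝ≥0∞) ^ d * 2⁻¹ ^ m) atTop (𝓝 (2 ^ d * 0)) :=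
      ENNReal.Tendsto.const_mul (ENNReal.tendsto_pow_atTop_nhds_zero_of_lt_one (by simp))
        (Or.inr (by simp))
    rw [mul_zero] at hgeo
    refine tendsto_of_tendsto_of_tendsto_of_le_of_le tendsto_const_nhds hgeo (fun m => zero_le)
      fun m => ?_
    dsimp only
    rw [hcast]
    exact hphi m (s m)

end parameters

/-- The positive part of the kernel as a function of the distance. -/
def posKernel (d : ℕ) (α : ℝ) (t : ℝ≥0∞) : ℝ≥0∞ :=
  if α = 2 ∧ d = 2 then (-ENNReal.log t).toENNReal else t ^ (α - (d : ℝ))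

lemma toENNReal_kernel (α : ℝ) (x y : EuclideanSpace ℝ (Fin d)) :
    (kernel α x y).toENNReal = posKernel d α (edist x y) := by
  unfold kernel posKernel
  split_ifs <;> simp

lemma rpow_neg_antitone {s : ℝ} (hs : s ≤ 0) : Antitone fun t : ℝ≥0∞ => t ^ s := by
  intro t u htu
  obtain ⟨r, rfl⟩ : ∃ r, s = -r := ⟨-s, (neg_neg s).symm⟩
  dsimp only
  rw [ENNReal.rpow_neg, ENNReal.rpow_neg, ENNReal.inv_le_inv]
  exact ENNReal.rpow_le_rpow htu (by linarith)

lemma posKernel_antitone {α : ℝ} (hd : 2 ≤ d) (hα2 : α ≤ 2) : Antitone (posKernel d α) := by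
  unfold posKernel
  split_ifs with h
  · intro t u htu
    exact EReal.toENNReal_le_toENNReal (EReal.neg_le_neg_iff.2 (ENNReal.log_monotone htu))
  · have : (2 : ℝ) ≤ d := by exact_mod_cast hd
    exact rpow_neg_antitone (by linarith)

/-- The real valued kernel as a function of the distance. -/
def realKernel (d : ℕ) (α t : ℝ) : ℝ := if α = 2 ∧ d = 2 then -Real.log t else t ^ (α - (d : ℝ))

lemma posKernel_ofReal (d : ℕ) (α : ℝ) {t : ℝ} (ht : 0 < t) :
    posKernel d α (ENNReal.ofReal t) = ENNReal.ofReal (realKernel d α t) := by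
  unfold posKernel realKernel
  split_ifs with h
  · rw [ENNReal.log_ofReal_of_pos ht, ← EReal.coe_neg]
    rfl
  · exact ENNReal.ofReal_rpow_of_pos ht

lemma capFn_eq_inv (d : ℕ) (α : ℝ) {t : ℝ} (ht : 0 < t) : capFn d α t = (realKernel d α t)⁻¹ := by
  unfold capFn realKernel
  split_ifs with h
  · rw [one_div, Real.log_inv]
  · rw [← Real.rpow_neg ht.le, neg_sub]

lemma lt_of_not_log {α : ℝ} (hd : 2 ≤ d) (hα2 : α ≤ 2) (h : ¬(α = 2 ∧ d = 2)) : α < d := by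
  have hd' : (2 : ℝ) ≤ d := by exact_mod_cast hd
  refine lt_of_le_of_ne (hα2.trans hd') fun he => h ⟨by linarith, ?_⟩
  have : (d : ℝ) = 2 := by linarith
  exact_mod_cast this

lemma tendsto_realKernel {α : ℝ} (hd : 2 ≤ d) (hα2 : α ≤ 2) :
    Tendsto (realKernel d α) (𝓝[>] 0) atTop := by
  unfold realKernel
  split_ifs with h
  · exact tendsto_neg_atBot_atTop.comp Real.tendsto_log_nhdsGT_zero
  · exact tendsto_rpow_neg_nhdsGT_zero (sub_neg.2 (lt_of_not_log hd hα2 h))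

lemma tendsto_pow_mul_realKernel {α : ℝ} (hα0 : 0 < α) :
    Tendsto (fun t => t ^ d * realKernel d α t) (𝓝[>] 0) (𝓝 0) := by
  unfold realKernel
  split_ifs with h
  · have h1 := (tendsto_log_mul_rpow_nhdsGT_zero (r := 2) two_pos).neg
    rw [neg_zero] at h1
    refine h1.congr fun t => ?_
    rw [h.2, Real.rpow_two]
    ring
  · have h1 : Tendsto (fun t : ℝ => t ^ α) (𝓝[>] 0) (𝓝 0) := by
      have h2 := (Real.continuousAt_rpow_const 0 α (Or.inr hα0.le)).tendsto
      rw [Real.zero_rpow hα0.ne'] at h2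
      exact h2.mono_left nhdsWithin_le_nhds
    refine h1.congr' ?_
    filter_upwards [self_mem_nhdsWithin] with t ht
    rw [← Real.rpow_natCast, ← Real.rpow_add ht]
    congr 1
    ring

/-- The doubling constant of the kernel. -/
def doublingConst (d : ℕ) (α : ℝ) : ℝ≥0∞ := if α = 2 ∧ d = 2 then 2 else 2 ^ ((d : ℝ) - α)

lemma doublingConst_lt {α : ℝ} (hα0 : 0 < α) : doublingConst d α < 2 ^ d := by
  unfold doublingConst
  split_ifs with h
  · rw [h.2]; norm_num
  · rw [← ENNReal.rpow_natCast]
    exact ENNReal.rpow_lt_rpow_of_exponent_lt (by norm_num) (by simp) (by linarith)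

lemma rpow_half_eq {s : ℝ} (hs : s ≤ 0) (t : ℝ≥0∞) : (t / 2) ^ s = 2 ^ (-s) * t ^ s := by
  obtain ⟨r, rfl⟩ : ∃ r, s = -r := ⟨-s, (neg_neg s).symm⟩
  rw [ENNReal.rpow_neg, ENNReal.div_rpow_of_nonneg _ _ (by linarith),
    ENNReal.inv_div (by left; simp) (by left; simp), neg_neg,
    ENNReal.rpow_neg, div_eq_mul_inv]

lemma posKernel_half_le {α : ℝ} (hd : 2 ≤ d) (hα2 : α ≤ 2) (t : ℝ≥0∞) (ht : t ≤ 1 / 2) :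
    posKernel d α (t / 2) ≤ doublingConst d α * posKernel d α t := by
  by_cases h : α = 2 ∧ d = 2
  · rcases eq_or_ne t 0 with rfl | ht0
    · simp [posKernel, doublingConst, h]
    have htt : t ≠ ⊤ := ne_top_of_le_ne_top (by simp) ht
    have hpos := ENNReal.toReal_pos ht0 htt
    have ht' : t.toReal ≤ 1 / 2 := by
      have := ENNReal.toReal_mono (by simp) ht
      simpa using this
    have e : t / 2 = ENNReal.ofReal (t.toReal / 2) := by
      rw [ENNReal.ofReal_div_of_pos two_pos, ENNReal.ofReal_toReal htt, ENNReal.ofReal_ofNat]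
    rw [e, posKernel_ofReal _ _ (by positivity)]
    nth_rewrite 2 [← ENNReal.ofReal_toReal htt]
    rw [posKernel_ofReal _ _ hpos, doublingConst, if_pos h, ← ENNReal.ofReal_ofNat,
      ← ENNReal.ofReal_mul (by norm_num)]
    refine ENNReal.ofReal_le_ofReal ?_
    rw [realKernel, if_pos h, realKernel, if_pos h, Real.log_div hpos.ne' two_ne_zero]
    have := Real.log_le_log hpos ht'
    rw [one_div, Real.log_inv] at this
    linarith
  · rw [posKernel, if_neg h, posKernel, if_neg h, doublingConst, if_neg h, rpow_half_eq]
    · rw [neg_sub]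
    · exact (sub_neg.2 (lt_of_not_log hd hα2 h)).le

lemma lintegral_posKernel_lt_top {α : ℝ} {ν : Measure (EuclideanSpace ℝ (Fin d))}
    {x : EuclideanSpace ℝ (Fin d)} (h : potential α ν x < ⊤) (hneg : negPotential α ν x < ⊤) :
    ∫⁻ y, posKernel d α (edist x y) ∂ν < ⊤ := by
  by_contra hcon
  rw [not_lt_top_iff] at hcon
  refine h.ne ?_
  rw [potential]
  simp only [toENNReal_kernel, hcon]
  exact EReal.top_sub (by simpa using hneg.ne)

lemma lintegral_posKernel_eq_top {α : ℝ} {ν : Measure (EuclideanSpace ℝ (Fin d))}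
    {x : EuclideanSpace ℝ (Fin d)} (h : potential α ν x = ⊤) :
    ∫⁻ y, posKernel d α (edist x y) ∂ν = ⊤ := by
  by_contra hcon
  refine absurd h (ne_of_lt ?_)
  rw [potential]
  simp only [toENNReal_kernel]
  rw [sub_eq_add_neg]
  refine EReal.add_lt_top (by simpa using hcon) ?_
  rw [ne_eq, EReal.neg_eq_top_iff]
  exact (EReal.bot_lt_coe_ennreal _).ne'

/-- Far away masses do not contribute infinitely much to a potential. -/
lemma exists_far_lintegral_lt_top {α : ℝ} (hd : 2 ≤ d) (hα2 : α ≤ 2)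
    {ν : Measure (EuclideanSpace ℝ (Fin d))} {x₀ : EuclideanSpace ℝ (Fin d)}
    (h₀ : ∫⁻ y, posKernel d α (edist x₀ y) ∂ν < ⊤) :
    ∃ R : ℝ, ∀ x ∈ Metric.ball (0 : EuclideanSpace ℝ (Fin d)) 1,
      ∫⁻ y in (Metric.ball 0 R)ᶜ, posKernel d α (edist x y) ∂ν < ⊤ := by
  have hmeas : ∀ R : ℝ, MeasurableSet (Metric.ball (0 : EuclideanSpace ℝ (Fin d)) R)ᶜ :=
    fun R => Metric.isOpen_ball.measurableSet.compl
  by_cases h : α = 2 ∧ d = 2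
  · refine ⟨2, fun x hx => ?_⟩
    rw [setLIntegral_congr_fun (g := fun _ => 0) (hmeas 2) fun y hy => ?_]
    · simp
    have h1 : 1 ≤ dist x y := by
      have h2 : ‖x‖ < 1 := by simpa using hx
      have h3 : 2 ≤ ‖y‖ := by simpa using hy
      have h4 := norm_sub_norm_le y x
      rw [dist_comm, dist_eq_norm]
      linarith
    dsimp only
    rw [edist_dist, posKernel_ofReal _ _ (by linarith), realKernel, if_pos h]
    exact ENNReal.ofReal_of_nonpos (by linarith [Real.log_nonneg h1])
  · refine ⟨‖x₀‖ + 2, fun x hx => ?_⟩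
    have hs := (sub_neg.2 (lt_of_not_log hd hα2 h)).le
    calc ∫⁻ y in (Metric.ball 0 (‖x₀‖ + 2))ᶜ, posKernel d α (edist x y) ∂ν
        ≤ ∫⁻ y in (Metric.ball 0 (‖x₀‖ + 2))ᶜ,
            2 ^ (-(α - (d : ℝ))) * posKernel d α (edist x₀ y) ∂ν := by
          refine setLIntegral_mono' (hmeas _) fun y hy => ?_
          rw [posKernel, if_neg h, posKernel, if_neg h, ← rpow_half_eq hs]
          refine rpow_neg_antitone hs ?_
          have h2 : ‖x‖ < 1 := by simpa using hx
          have h3 : ‖x₀‖ + 2 ≤ ‖y‖ := by simpa using hy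
          have h4 := norm_sub_norm_le y x
          have h5 := norm_sub_le x₀ y
          rw [edist_dist, edist_dist]
          refine ENNReal.div_le_of_le_mul ?_
          rw [mul_two, ← ENNReal.ofReal_add dist_nonneg dist_nonneg]
          refine ENNReal.ofReal_le_ofReal ?_
          rw [dist_comm x y, dist_eq_norm, dist_eq_norm]
          linarith
      _ ≤ ∫⁻ y, 2 ^ (-(α - (d : ℝ))) * posKernel d α (edist x₀ y) ∂ν := setLIntegral_le_lintegral _ _
      _ < ⊤ := by
          have h6 : (2 : ℝ≥0∞) ^ (-(α - (d : ℝ))) ≠ ⊤ := by simp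
          rw [lintegral_const_mul' _ _ h6]
          exact ENNReal.mul_lt_top h6.lt_top h₀

/-- A set that carries a probability measure with bounded potential is not polar. -/
lemma not_isPolar_of_bounded_potential {α : ℝ} (hd : 2 ≤ d) (hα2 : α ≤ 2)
    {F : Set (EuclideanSpace ℝ (Fin d))} (hF : F ⊆ Metric.ball 0 1)
    {μ : Measure (EuclideanSpace ℝ (Fin d))} (hμ1 : μ univ = 1) (hμF : μ Fᶜ = 0) {K : ℝ≥0∞}
    (hK : K ≠ ⊤) (hμK : ∀ y, ∫⁻ x, posKernel d α (edist x y) ∂μ ≤ K) :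
    ¬ IsPolar α F := by
  rintro ⟨ν, hν, hneg, ⟨x₀, hx₀⟩, hFν⟩
  have : IsProbabilityMeasure μ := ⟨hμ1⟩
  obtain ⟨R, hR⟩ := exists_far_lintegral_lt_top hd hα2 (lintegral_posKernel_lt_top hx₀ (hneg x₀))
  have hball : MeasurableSet (Metric.ball (0 : EuclideanSpace ℝ (Fin d)) R) :=
    Metric.isOpen_ball.measurableSet
  have hnear : ∀ x ∈ F, ∫⁻ y in Metric.ball 0 R, posKernel d α (edist x y) ∂ν = ⊤ := by
    intro x hx
    have h1 := lintegral_posKernel_eq_top (hFν x hx)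
    rw [← lintegral_add_compl _ hball, ENNReal.add_eq_top] at h1
    exact h1.resolve_right (hR x (hF hx)).ne
  have htop : ∫⁻ x, ∫⁻ y in Metric.ball 0 R, posKernel d α (edist x y) ∂ν ∂μ = ⊤ := by
    rw [lintegral_congr_ae (g := fun _ => ⊤)]
    · simp [hμ1]
    · have : ∀ᵐ x ∂μ, x ∈ F := hμF
      filter_upwards [this] with x hx using hnear x hx
  have hmeas : Measurable (posKernel d α) := (posKernel_antitone hd hα2).measurable
  have hmeas2 : Measurable (Function.uncurry fun x y : EuclideanSpace ℝ (Fin d) =>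
      posKernel d α (edist x y)) := hmeas.comp measurable_edist
  rw [lintegral_lintegral_swap hmeas2.aemeasurable] at htop
  refine absurd htop (ne_of_lt ?_)
  calc ∫⁻ y in Metric.ball 0 R, ∫⁻ x, posKernel d α (edist x y) ∂μ ∂ν
      ≤ ∫⁻ _y in Metric.ball 0 R, K ∂ν := lintegral_mono hμK
    _ = K * ν (Metric.ball 0 R) := setLIntegral_const _ _
    _ < ⊤ := ENNReal.mul_lt_top hK.lt_top measure_ball_lt_top

lemma frequently_mul_posKernel_lt {α : ℝ} (hd : 2 ≤ d) (hα2 : α ≤ 2) {φ : ℝ → ℝ≥0∞}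
    (hlim : liminf (fun t : ℝ => φ t / ENNReal.ofReal (capFn d α t)) (𝓝[>] (0 : ℝ)) = 0)
    (ε : ℝ≥0∞) (hε : 0 < ε) :
    ∃ᶠ t in 𝓝[>] (0 : ℝ), φ t * posKernel d α (ENNReal.ofReal t) < ε := by
  have h1 : ∃ᶠ t in 𝓝[>] (0 : ℝ), φ t / ENNReal.ofReal (capFn d α t) < ε :=
    frequently_lt_of_liminf_lt (by isBoundedDefault) (by rwa [hlim])
  have h2 : ∀ᶠ t in 𝓝[>] (0 : ℝ), 0 < t := self_mem_nhdsWithin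
  have h3 := (tendsto_realKernel hd hα2).eventually (eventually_gt_atTop 0)
  refine (h1.and_eventually (h2.and h3)).mono fun t ⟨ht1, ht2, ht3⟩ => ?_
  rw [posKernel_ofReal _ _ ht2]
  rwa [capFn_eq_inv _ _ ht2, ENNReal.ofReal_inv_of_pos ht3, div_eq_mul_inv, inv_inv] at ht1

end

end CantorPotential

end

theorem theorem8p7 (d : ℕ) (hd : 2 ≤ d) (α : ℝ) (hα0 : 0 < α) (hα2 : α ≤ 2)
    (φ : ℝ → ℝ≥0∞) (hφ : CantorPotential.IsMeasureFunction φ)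
    (hlim : liminf (fun t : ℝ => φ t / ENNReal.ofReal (CantorPotential.capFn d α t))
      (𝓝[>] (0 : ℝ)) = 0) :
    ∃ F : Set (EuclideanSpace ℝ (Fin d)),
      IsCompact F ∧ F ⊆ Metric.ball 0 1 ∧
      CantorPotential.IsCantorType F ∧
      ¬ CantorPotential.IsPolar α F ∧
      CantorPotential.hausdorffM φ F = 0 ∧
      IsConnected (Metric.ball (0 : EuclideanSpace ℝ (Fin d)) 1 \ F) := by
  open CantorPotential in
  have hd0 : 0 < d := by omega
  have hfin : ∀ t : ℝ, 0 < t → posKernel d α (ENNReal.ofReal t) ≠ ⊤ := fun t ht => by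
    rw [posKernel_ofReal _ _ ht]
    exact ENNReal.ofReal_ne_top
  have hpos : ∀ᶠ t in 𝓝[>] (0 : ℝ), 0 < t := self_mem_nhdsWithin
  have hgtop : Tendsto (fun t : ℝ => posKernel d α (ENNReal.ofReal t)) (𝓝[>] 0) (𝓝 ⊤) :=
    (ENNReal.tendsto_ofReal_atTop.comp (tendsto_realKernel hd hα2)).congr' (by
      filter_upwards [hpos] with t ht using (posKernel_ofReal d α ht).symm)
  have hgd : Tendsto (fun t : ℝ => ENNReal.ofReal t ^ d * posKernel d α (ENNReal.ofReal t))
      (𝓝[>] 0) (𝓝 0) := by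
    have h1 := ENNReal.tendsto_ofReal (tendsto_pow_mul_realKernel (d := d) hα0)
    rw [ENNReal.ofReal_zero] at h1
    refine h1.congr' ?_
    filter_upwards [hpos] with t ht
    rw [posKernel_ofReal _ _ ht, ENNReal.ofReal_mul (by positivity), ENNReal.ofReal_pow ht.le]
  obtain ⟨a, p, ha0, ha, hp, hap, hsum, hN⟩ := exists_parameters hd0 hgtop hgd hfin
    (frequently_mul_posKernel_lt hd hα2 hlim)
  have hn : ∀ m, 2 ≤ 2 ^ p m := fun m => by
    simpa using pow_le_pow_right₀ (one_le_two (α := ℕ)) (hp m)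
  have hcast : ∀ m, 2 * a (m + 1) < a m / ((2 ^ p m : ℕ) : ℝ) := fun m => by
    push_cast
    exact hap m
  have H : Admissible (halfSide d a) fun m => 2 ^ p m := admissible_halfSide hd0 ha hn hcast
  have hhalf : ∀ m, a (m + 1) ≤ a m * (1 / 2) := fun m => by
    have h1 : a m / 2 ^ p m ≤ a m := div_le_self (ha m).le (one_le_pow₀ one_le_two)
    linarith [hap m]
  have hanti : Antitone a := antitone_nat_of_succ_le fun m => by linarith [hhalf m, ha m]
  have hgeo : ∀ m, a m ≤ (1 / 2) * (1 / 2) ^ m := fun m => by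
    induction m with
    | zero => rw [ha0]; norm_num
    | succ m ih => rw [pow_succ]; linarith [hhalf m]
  have hlim0 : Tendsto a atTop (𝓝 0) := by
    refine squeeze_zero (fun m => (ha m).le) hgeo ?_
    have h1 := (tendsto_pow_atTop_nhds_zero_of_lt_one (r := (1 / 2 : ℝ)) (by norm_num)
      (by norm_num)).const_mul (1 / 2)
    rwa [mul_zero] at h1
  have hball : cantorSet d (halfSide d a) (fun m => 2 ^ p m) ⊆ Metric.closedBall 0 (1 / 4) := by
    intro y hy
    have h1 : y ∈ cube (0 : EuclideanSpace ℝ (Fin d)) (a 0) := fun i => by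
      simpa [halfSide] using abs_le_of_mem_cantorSet hy i
    have h2 := cube_subset_closedBall hd0 _ (ha 0).le h1
    rw [ha0] at h2
    convert h2 using 2
    norm_num
  have hball1 := hball.trans (Metric.closedBall_subset_ball (show (1 / 4 : ℝ) < 1 by norm_num))
  have hg0 : posKernel d α (ENNReal.ofReal (a 0)) ≠ 0 := by
    rw [posKernel_ofReal _ _ (ha 0), ha0]
    refine (ENNReal.ofReal_pos.2 ?_).ne'
    unfold realKernel
    split_ifs
    · exact neg_pos.2 (Real.log_neg (by norm_num) (by norm_num))
    · positivity
  obtain ⟨K, hK, hμK⟩ := exists_lintegral_le hd0 (posKernel_antitone hd hα2) ha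
    (fun m => ha0 ▸ hanti (Nat.zero_le m)) hlim0 hanti hg0 (hfin _ (ha 0)) H
    (doublingConst_lt hα0) (posKernel_half_le hd hα2) hsum
  refine ⟨cantorSet d (halfSide d a) fun m => 2 ^ p m,
    (isCompact_closedBall _ _).of_isClosed_subset (isClosed_cantorSet d _ _) hball, hball1,
    ⟨0, a, _, ha, hn, hcast, cantorSet_eq_iInter H⟩,
    not_isPolar_of_bounded_potential hd hα2 hball1 (cantorMeasure_univ H) (cantorMeasure_compl H)
      hK hμK,
    hausdorffM_cantorSet_eq_zero hd0 ha hφ hlim0 hN, isConnected_ball_diff_cantorSet hd ?_⟩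
  have h1 : 1 ≤ √(d : ℝ) := Real.one_le_sqrt.2 (by exact_mod_cast hd0)
  rw [halfSide, ha0, div_lt_iff₀ (by positivity)]
  linarith
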